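/- Inner product spaces are complex, and for linear operators $S,T$ in a Hilbert space the product $ST$ has its natural domain $D(ST)=\{x\in D(T): Tx\in D(S)\}$. A linear operator $T:D(T)\subset H\to H$ is called paranormal if $\|Tx\|^2\le \|T^2x\|\,\|x\|$ for all $x\in D(T^2)$, and closable if it has a closed linear extension (equivalently, if the closure of its graph is the graph of an operator). (a) Let $H\neq\{0\}$ be a Hilbert space and let $T$ be a densely defined linear operator in $H$ with $D(T^2)=D(T^*)=\{0\}$. Then $T$ is paranormal and is not closable. (b) Such an operator exists. Let $\mathcal F$ be the unitary Fourier transform on $L^2(\mathbb R)$, normalized by $\mathcal Ff(\xi)=(2\pi)^{-1/2}\int_{\mathbb R} f(x)e^{-ix\xi}\,dx$ for Schwartz functions $f$. Let $Af(x)=e^{x^2/2}f(x)$ on $D(A)=\{f\in L^2(\mathbb R): e^{x^2/2}f\in L^2(\mathbb R)\}$, let $B=\mathcal F^*A\mathcal F$, and let $T=A^{-1}B$, where $A^{-1}$ is defined on the range of $A$. Then $T$ is densely defined, $D(T^2)=D(T^*)=\{0\}$, and $T$ is paranormal but not closable. In particular, the adjoint of a densely defined paranormal operator can have trivial domain. 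-/

import Mathlib

open MeasureTheory Filter
open scoped LinearPMap FourierTransform

noncomputable section

/-! ### Unbounded operators -/

namespace UnboundedOp

variable {E F G H : Type*} [AddCommGroup E] [Module ℂ E] [AddCommGroup F] [Module ℂ F]
  [AddCommGroup G] [Module ℂ G] [NormedAddCommGroup H] [InnerProductSpace ℂ H]

/-- The product `S T` of two unbounded operators on its natural domain
`D(ST) = {x ∈ D(T) : T x ∈ D(S)}`. -/
def prod (S : F →ₗ.[ℂ] G) (T : E →ₗ.[ℂ] F) : E →ₗ.[ℂ] G where
  domain := (S.domain.comap T.toFun).map T.domain.subtype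
  toFun :=
    { toFun := fun x => S ⟨T ⟨x, by
          obtain ⟨y, -, hy⟩ := x.2
          exact hy ▸ y.2⟩, by
          obtain ⟨x, y, hy, rfl⟩ := x
          exact hy⟩
      map_add' := fun x y => by
        rw [← LinearPMap.map_add]
        congr 1
        apply Subtype.ext
        exact LinearPMap.map_add T ⟨(x : E), (x.2.choose_spec.2 ▸ x.2.choose.2)⟩ ⟨(y : E), (y.2.choose_spec.2 ▸ y.2.choose.2)⟩
      map_smul' := fun c x => by
        rw [RingHom.id_apply, ← LinearPMap.map_smul]
        congr 1
        apply Subtype.ext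
        exact LinearPMap.map_smul T c ⟨(x : E), (x.2.choose_spec.2 ▸ x.2.choose.2)⟩ }

theorem mem_prod_domain {S : F →ₗ.[ℂ] G} {T : E →ₗ.[ℂ] F} {x : E} :
    x ∈ (prod S T).domain ↔ ∃ hx : x ∈ T.domain, T ⟨x, hx⟩ ∈ S.domain := by
  constructor
  · rintro ⟨y, hy, rfl⟩
    exact ⟨y.2, hy⟩
  · rintro ⟨hx, h⟩
    exact ⟨⟨x, hx⟩, h, rfl⟩

theorem prod_apply {S : F →ₗ.[ℂ] G} {T : E →ₗ.[ℂ] F} (x : (prod S T).domain) :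
    prod S T x = S ⟨T ⟨x, (mem_prod_domain.1 x.2).1⟩, (mem_prod_domain.1 x.2).2⟩ :=
  rfl

/-- `T² = T T`, on `D(T²) = {x ∈ D(T) : T x ∈ D(T)}`. -/
def sq (T : E →ₗ.[ℂ] E) : E →ₗ.[ℂ] E := prod T T

theorem mem_domain_of_mem_sq {T : E →ₗ.[ℂ] E} (x : (sq T).domain) : (x : E) ∈ T.domain :=
  (mem_prod_domain.1 x.2).1

/-- `T` is paranormal: `‖T x‖² ≤ ‖T² x‖ ‖x‖` for all `x ∈ D(T²)`. -/
def IsParanormal (T : H →ₗ.[ℂ] H) : Prop :=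
  ∀ x : (sq T).domain, ‖T ⟨x, mem_domain_of_mem_sq x⟩‖ ^ 2 ≤ ‖sq T x‖ * ‖(x : H)‖

end UnboundedOp

/-! ### Multiplication operators and the Fourier transform on `L²(ℝ)` -/

namespace L2Line

/-- The complex Hilbert space `L²(ℝ)`. -/
abbrev L2R : Type := Lp ℂ 2 (volume : Measure ℝ)

/-- The operator `f ↦ m f` of multiplication by a function `m`, on its maximal domain
`{f ∈ L²(ℝ) : m f ∈ L²(ℝ)}`. -/
def mulOp (m : ℝ → ℝ) : L2R →ₗ.[ℂ] L2R where
  domain :=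
    { carrier := {f : L2R | MemLp (fun x => (m x : ℂ) * f x) 2 volume}
      zero_mem' := by
        refine (memLp_congr_ae ?_).2 (MemLp.zero (ε := ℂ) (p := 2) (μ := (volume : Measure ℝ)))
        filter_upwards [Lp.coeFn_zero ℂ 2 (volume : Measure ℝ)] with x hx
        simp
      add_mem' := fun {f g} hf hg => by
        refine (memLp_congr_ae ?_).2 (MemLp.add hf hg)
        filter_upwards [Lp.coeFn_add f g] with x hx
        have hx' : (f + g : L2R) x = f x + g x := hx
        exact (congrArg ((m x : ℂ) * ·) hx').trans (mul_add _ _ _)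
      smul_mem' := fun c f hf => by
        refine (memLp_congr_ae ?_).2 (MemLp.const_smul hf c)
        filter_upwards [Lp.coeFn_smul c f] with x hx
        simp [hx, mul_left_comm] }
  toFun :=
    { toFun := fun f => MemLp.toLp _ f.2
      map_add' := fun f g => by
        rw [← MemLp.toLp_add]
        apply MemLp.toLp_congr
        filter_upwards [Lp.coeFn_add (f : L2R) g] with x hx
        have hx' : ((f : L2R) + g : L2R) x = (f : L2R) x + (g : L2R) x := hx
        exact (congrArg ((m x : ℂ) * ·) hx').trans (mul_add _ _ _)
      map_smul' := fun c f => by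
        rw [RingHom.id_apply, ← MemLp.toLp_const_smul]
        apply MemLp.toLp_congr
        filter_upwards [Lp.coeFn_smul c (f : L2R)] with x hx
        simp [hx, mul_left_comm] }

theorem quasiMeasurePreserving_mul {c : ℝ} (hc : c ≠ 0) :
    Measure.QuasiMeasurePreserving (fun x : ℝ => c * x) volume volume := by
  refine ⟨measurable_const_mul c, ?_⟩
  rw [Real.map_volume_mul_left hc]
  exact Measure.smul_absolutelyContinuous

theorem eLpNorm_dilation {c : ℝ} (hc : 0 < c) (f : L2R) :
    eLpNorm (fun x => (√c : ℂ) * f (c * x)) 2 volume = eLpNorm f 2 volume := by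
  have h1 : eLpNorm (fun x => f (c * x)) 2 volume
      = ENNReal.ofReal c⁻¹ ^ (1 / (2 : ENNReal)).toReal * eLpNorm f 2 volume := by
    have h := eLpNorm_map_measure (p := 2) (μ := (volume : Measure ℝ)) (f := fun x : ℝ => c * x)
      (g := f) ((Lp.aestronglyMeasurable f).mono_ac
        (quasiMeasurePreserving_mul hc.ne').absolutelyContinuous)
      (measurable_const_mul c).aemeasurable
    rw [Real.map_volume_mul_left hc.ne', eLpNorm_smul_measure_of_ne_top (by simp),
      abs_of_pos (inv_pos.2 hc)] at h
    exact h.symm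
  have h2 : eLpNorm (fun x => (√c : ℂ) * f (c * x)) 2 volume
      = ‖(√c : ℂ)‖ₑ * eLpNorm (fun x => f (c * x)) 2 volume :=
    eLpNorm_const_smul (√c : ℂ) (fun x => f (c * x)) 2 volume
  have h3 : ‖(√c : ℂ)‖ₑ = ENNReal.ofReal √c := by
    rw [← ofReal_norm, Complex.norm_real, Real.norm_of_nonneg (Real.sqrt_nonneg _)]
  have h4 : (1 / (2 : ENNReal)).toReal = 1 / 2 := by simp
  rw [h2, h1, h3, h4, ENNReal.ofReal_rpow_of_pos (inv_pos.2 hc), ← Real.sqrt_eq_rpow, ← mul_assoc,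
    ← ENNReal.ofReal_mul (Real.sqrt_nonneg _), ← Real.sqrt_mul hc.le, mul_inv_cancel₀ hc.ne',
    Real.sqrt_one, ENNReal.ofReal_one, one_mul]

theorem memLp_dilation {c : ℝ} (hc : 0 < c) (f : L2R) :
    MemLp (fun x => (√c : ℂ) * f (c * x)) 2 volume := by
  refine ⟨?_, ?_⟩
  · exact ((Lp.aestronglyMeasurable f).comp_quasiMeasurePreserving
      (quasiMeasurePreserving_mul hc.ne')).const_mul _
  · rw [eLpNorm_dilation hc]
    exact Lp.eLpNorm_lt_top f

/-- The unitary dilation `(D_c f)(x) = √c f(c x)`, as a linear isometry. -/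
def dilationₗᵢ (c : ℝ) (hc : 0 < c) : L2R →ₗᵢ[ℂ] L2R where
  toFun f := (memLp_dilation hc f).toLp
  map_add' f g := by
    rw [← MemLp.toLp_add]
    apply MemLp.toLp_congr
    filter_upwards [(quasiMeasurePreserving_mul hc.ne').ae (Lp.coeFn_add f g)] with x hx
    have hx' : (f + g : L2R) (c * x) = f (c * x) + g (c * x) := hx
    exact (congrArg ((√c : ℂ) * ·) hx').trans (mul_add _ _ _)
  map_smul' a f := by
    rw [RingHom.id_apply, ← MemLp.toLp_const_smul]
    apply MemLp.toLp_congr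
    filter_upwards [(quasiMeasurePreserving_mul hc.ne').ae (Lp.coeFn_smul a f)] with x hx
    simp [hx, mul_left_comm]
  norm_map' f := by
    change ‖(memLp_dilation hc f).toLp‖ = ‖f‖
    rw [Lp.norm_toLp, eLpNorm_dilation hc, Lp.norm_def]

theorem dilationₗᵢ_coeFn {c : ℝ} (hc : 0 < c) (f : L2R) :
    dilationₗᵢ c hc f =ᵐ[volume] fun x => (√c : ℂ) * f (c * x) :=
  MemLp.coeFn_toLp (memLp_dilation hc f)

/-- The unitary Fourier transform on `L²(ℝ)`, in the normalization
`(ℱ f)(ξ) = (2π)^(-1/2) ∫ f(x) e^(-ixξ) dx`. Mathlib's Fourier transform on `L²(ℝ)` extends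
`(𝓕 f)(ξ) = ∫ f(x) e^(-2πixξ) dx`, hence `(ℱ f)(ξ) = (2π)^(-1/2) (𝓕 f)(ξ / 2π)`. -/
def fourierL2 : L2R →L[ℂ] L2R :=
  ((dilationₗᵢ (2 * Real.pi)⁻¹ (by positivity)).comp
    (Lp.fourierTransformₗᵢ ℝ ℂ).toLinearIsometry).toContinuousLinearMap

/-- On Schwartz functions, `fourierL2` is given by the usual Fourier integral. -/
theorem fourierL2_schwartz (f : SchwartzMap ℝ ℂ) :
    fourierL2 (f.toLp 2) =ᵐ[volume] fun ξ : ℝ =>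
      ((√(2 * Real.pi))⁻¹ : ℂ) * ∫ x : ℝ, Complex.exp (-(Complex.I * x * ξ)) * f x := by
  have hc : (0 : ℝ) < (2 * Real.pi)⁻¹ := by positivity
  have h0 : fourierL2 (f.toLp 2) = dilationₗᵢ _ hc ((𝓕 f).toLp 2) := by
    rw [← SchwartzMap.toLp_fourier_eq]
    rfl
  rw [h0]
  filter_upwards [dilationₗᵢ_coeFn hc ((𝓕 f).toLp 2), (quasiMeasurePreserving_mul hc.ne').ae
    ((𝓕 f).coeFn_toLp 2 volume)] with ξ h1 h2
  rw [h1, h2, SchwartzMap.fourier_coe, Real.fourier_real_eq_integral_exp_smul, Real.sqrt_inv,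
    Complex.ofReal_inv]
  congr 1
  refine integral_congr_ae (Eventually.of_forall fun x => ?_)
  simp only [smul_eq_mul]
  congr 2
  have hπ : (Real.pi : ℂ) ≠ 0 := by exact_mod_cast Real.pi_ne_zero
  push_cast
  field_simp

/-- An everywhere defined bounded operator, viewed as an unbounded operator. -/
def ofBounded (S : L2R →L[ℂ] L2R) : L2R →ₗ.[ℂ] L2R :=
  (S : L2R →ₗ[ℂ] L2R).toPMap ⊤

/-- `A`: multiplication by `e^(x²/2)` on `D(A) = {f ∈ L²(ℝ) : e^(x²/2) f ∈ L²(ℝ)}`. -/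
def opA : L2R →ₗ.[ℂ] L2R := mulOp fun x => Real.exp (x ^ 2 / 2)

/-- `A` is injective, so that `opA.inverse` is its inverse, with domain the range of `A`. -/
theorem ker_opA : opA.toFun.ker = ⊥ := by
  refine LinearMap.ker_eq_bot'.2 fun f hf => ?_
  have h1 : (fun x => ((Real.exp (x ^ 2 / 2) : ℝ) : ℂ) * (f : L2R) x) =ᵐ[volume] 0 :=
    (MemLp.toLp_eq_toLp_iff f.2 MemLp.zero).1 (hf.trans (MemLp.toLp_zero _).symm)
  apply Subtype.ext
  refine Lp.ext ?_
  filter_upwards [h1, Lp.coeFn_zero ℂ 2 (volume : Measure ℝ)] with x hx h0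
  have h2 := (mul_eq_zero.1 hx).resolve_left (by exact_mod_cast (Real.exp_pos _).ne')
  rw [h2]
  exact h0.symm

/-- `B = ℱ* A ℱ`. -/
def opB : L2R →ₗ.[ℂ] L2R :=
  UnboundedOp.prod (ofBounded (ContinuousLinearMap.adjoint fourierL2))
    (UnboundedOp.prod opA (ofBounded fourierL2))

/-- `T = A⁻¹ B`. -/
def opT : L2R →ₗ.[ℂ] L2R := UnboundedOp.prod opA.inverse opB

end L2Line

end

/-!
Part (a) is soft. If `D(T²) = {0}`, paranormality is only tested at the zero vector. The orthogonal
complement of the graph of `T` in `H × H` is a rotated copy of the graph of `T*`; if `D(T*) = {0}`,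
it vanishes, so the graph of `T` is dense and its closure contains vectors `(0, v)` with `v ≠ 0`.

For part (b), `A` is symmetric and onto, with an everywhere defined symmetric inverse, and the
Fourier transform is unitary. Hence `T` is injective, its values lie in `D(A)`, and its domain is
`{f | ℱ f ∈ D(A)}`. If `f ∈ D(T²)`, then `g = T f` satisfies `g ∈ D(A)` and `ℱ g ∈ D(A)`. If
`h ∈ D(T*)`, testing against the vectors `ℱ* A⁻¹ u` gives `ℱ A⁻¹ h = A⁻¹ ℱ T* h`, so that
`g = A⁻¹ h` again satisfies `g ∈ D(A)` and `ℱ g ∈ D(A)`. Everything thus rests on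
`L2Line.eq_zero_of_mem_opA_domain`: such a `g` vanishes. This is the `L²` form of Hardy's
uncertainty principle (the theorem of Cowling and Price) at the critical exponent.

For its proof, `F(z) = e^(z²/2) ∫ g(x) e^(-ixz) dx` is an entire function bounded by
`C e^((re z)²/2)` and square integrable on the real axis, and such a function vanishes
(`GaussianGrowth.eq_zero_of_growth`). Differences `P(z + h) - P(z)` of a primitive of `F` are bounded
on both coordinate axes. A quadrant has the critical angle for growth of order two, so the
Phragmén–Lindelöf principle is applied in slightly smaller sectors after multiplication by
`e^(iδz²/2)`, which compensates the growth on the ray bounding the sector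
(`GaussianGrowth.norm_exp_strip_le`). As `δ → 0` the differences are seen to be bounded, hence
constant; so `F` is constant on the real axis, and being square integrable there, it is zero.
-/

/-! ### Entire functions of critical Gaussian growth -/

namespace GaussianGrowth

theorem norm_cexp_I_mul_sq (δ : ℝ) (z : ℂ) :
    ‖Complex.exp (Complex.I * (δ / 2 : ℝ) * z ^ 2)‖ = Real.exp (-(δ * (z.re * z.im))) := by
  rw [Complex.norm_exp]
  congr 1
  simp [pow_two, Complex.mul_re, Complex.mul_im]
  ring

/-- The Phragmén–Lindelöf step in the sector `0 ≤ arg z ≤ α`, opened to a strip by `z = e^w`. With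
`δ = cot α`, the factor `e^(iδz²/2)` has modulus one on the real axis, is bounded in the sector, and
absorbs the critical growth on the bounding ray `re z = δ im z`. As `α < π/2`, growth of order two
is admissible. -/
theorem norm_exp_strip_le {G : ℂ → ℂ} {C M α : ℝ} (hG : Differentiable ℂ G)
    (hb : ∀ z : ℂ, ‖G z‖ ≤ C * Real.exp ((|z.re| + 1) ^ 2 / 2))
    (hM : ∀ x : ℝ, 0 ≤ x → ‖G x‖ ≤ M) (h0 : 0 < α) (h1 : α < Real.pi / 2) {w : ℂ}
    (hw0 : 0 ≤ w.im) (hw1 : w.im ≤ α) :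
    ‖G (Complex.exp w)‖ ≤ max M (C * Real.exp 1) *
      Real.exp (Real.cos α / Real.sin α * ‖Complex.exp w‖ ^ 2) := by
  have hC : 0 ≤ C := nonneg_of_mul_nonneg_left ((norm_nonneg _).trans (hb 0)) (Real.exp_pos _)
  have hcos : 0 < Real.cos α := Real.cos_pos_of_mem_Ioo ⟨by linarith, h1⟩
  have hsin : 0 < Real.sin α := Real.sin_pos_of_pos_of_lt_pi h0 (by linarith)
  set δ := Real.cos α / Real.sin α with hδ
  have hδ0 : 0 < δ := div_pos hcos hsin
  set g : ℂ → ℂ := fun w =>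
    G (Complex.exp w) * Complex.exp (Complex.I * (δ / 2 : ℝ) * (Complex.exp w) ^ 2) with hg
  have hnorm : ∀ w, ‖g w‖ = ‖G (Complex.exp w)‖ *
      Real.exp (-(δ * ((Complex.exp w).re * (Complex.exp w).im))) := fun w => by
    rw [hg]; simp only [norm_mul, norm_cexp_I_mul_sq]
  have hgd : Differentiable ℂ g :=
    (hG.comp Complex.differentiable_exp).mul
      ((((Complex.differentiable_exp).pow 2).const_mul _).cexp)
  have key : ‖g w‖ ≤ max M (C * Real.exp 1) := by
    refine PhragmenLindelof.horizontal_strip (a := 0) (b := α) hgd.diffContOnCl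
      ⟨2, ?_, 2, ?_⟩ ?_ ?_ hw0 hw1
    · rw [sub_zero, lt_div_iff₀ h0]; linarith
    · refine Asymptotics.IsBigO.of_bound C ?_
      refine eventually_inf_principal.2 (Eventually.of_forall fun z hz => ?_)
      have hz' : 0 < z.im ∧ z.im < α := hz
      rw [hnorm, Real.norm_of_nonneg (Real.exp_pos _).le]
      have hre : 0 ≤ (Complex.exp z).re := by
        rw [Complex.exp_re]
        exact mul_nonneg (Real.exp_pos _).le
          (Real.cos_nonneg_of_mem_Icc ⟨by linarith, by linarith⟩)
      have him : 0 ≤ (Complex.exp z).im := by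
        rw [Complex.exp_im]
        exact mul_nonneg (Real.exp_pos _).le
          (Real.sin_nonneg_of_mem_Icc ⟨by linarith, by linarith⟩)
      have h2 : Real.exp (-(δ * ((Complex.exp z).re * (Complex.exp z).im))) ≤ 1 :=
        Real.exp_le_one_iff.2 (by have := mul_nonneg hδ0.le (mul_nonneg hre him); linarith)
      have h3 : |(Complex.exp z).re| + 1 ≤ 2 * Real.exp |z.re| := by
        have h4 : |(Complex.exp z).re| ≤ Real.exp z.re := by
          rw [← Complex.norm_exp]; exact Complex.abs_re_le_norm _
        have h5 : Real.exp z.re ≤ Real.exp |z.re| := Real.exp_le_exp.2 (le_abs_self _)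
        have h6 : 1 ≤ Real.exp |z.re| := Real.one_le_exp (abs_nonneg _)
        linarith
      have h7 : (|(Complex.exp z).re| + 1) ^ 2 / 2 ≤ 2 * Real.exp (2 * |z.re|) := by
        have h8 := pow_le_pow_left₀ (by positivity) h3 2
        rw [mul_pow, ← Real.exp_nat_mul] at h8
        push_cast at h8
        linarith
      calc _ ≤ ‖G (Complex.exp z)‖ * 1 := by gcongr
        _ ≤ _ := by
          rw [mul_one]
          exact (hb _).trans (by gcongr)
    · intro z hz
      have h2 : Complex.exp z = (Real.exp z.re : ℝ) := by
        apply Complex.ext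
        · rw [Complex.exp_re, hz]; simp [-Complex.ofReal_exp]
        · rw [Complex.exp_im, hz]; simp [-Complex.ofReal_exp]
      rw [hnorm, h2, Complex.ofReal_im, mul_zero, mul_zero, neg_zero, Real.exp_zero, mul_one]
      exact (hM _ (Real.exp_pos _).le).trans (le_max_left _ _)
    -- On the ray `re z = δ im z` the two exponents add up to `1 - (re z - 1)² / 2`.
    · intro z hz
      rw [hnorm]
      have hre : 0 ≤ (Complex.exp z).re := by
        rw [Complex.exp_re, hz]; positivity
      have him : δ * (Complex.exp z).im = (Complex.exp z).re := by
        rw [Complex.exp_re, Complex.exp_im, hz, hδ]; field_simp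
      have h2 : δ * ((Complex.exp z).re * (Complex.exp z).im) = (Complex.exp z).re ^ 2 := by
        rw [mul_left_comm, him, pow_two]
      refine le_trans ?_ (le_max_right _ _)
      calc _ ≤ C * Real.exp ((|(Complex.exp z).re| + 1) ^ 2 / 2) *
            Real.exp (-(δ * ((Complex.exp z).re * (Complex.exp z).im))) := by
              gcongr; exact hb _
        _ = C * Real.exp (((Complex.exp z).re + 1) ^ 2 / 2 - (Complex.exp z).re ^ 2) := by
              rw [mul_assoc, ← Real.exp_add, h2, abs_of_nonneg hre, sub_eq_add_neg]
        _ ≤ _ := by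
              gcongr
              nlinarith [sq_nonneg ((Complex.exp z).re - 1)]
  rw [hnorm, Real.exp_neg, ← div_eq_mul_inv, div_le_iff₀ (Real.exp_pos _)] at key
  refine key.trans ?_
  have hnn : 0 ≤ max M (C * Real.exp 1) := le_max_of_le_right (by positivity)
  gcongr
  rw [← Complex.normSq_eq_norm_sq, Complex.normSq_apply]
  nlinarith [sq_nonneg ((Complex.exp w).re - (Complex.exp w).im), sq_nonneg (Complex.exp w).re,
    sq_nonneg (Complex.exp w).im]

/-- Let `α → π/2` in `norm_exp_strip_le`: then `cot α → 0` and the loss disappears. -/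
theorem norm_le_of_quadrant {G : ℂ → ℂ} {C M : ℝ} (hG : Differentiable ℂ G)
    (hb : ∀ z : ℂ, ‖G z‖ ≤ C * Real.exp ((|z.re| + 1) ^ 2 / 2))
    (hM : ∀ x : ℝ, 0 ≤ x → ‖G x‖ ≤ M) {z : ℂ} (hx : 0 ≤ z.re) (hy : 0 ≤ z.im) :
    ‖G z‖ ≤ max M (C * Real.exp 1) := by
  have hC : 0 ≤ C := nonneg_of_mul_nonneg_left ((norm_nonneg _).trans (hb 0)) (Real.exp_pos _)
  rcases hx.eq_or_lt with hx | hx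
  · refine le_trans ((hb z).trans ?_) (le_max_right _ _)
    rw [← hx]
    gcongr
    norm_num
  have hz : z ≠ 0 := fun h => by simp [h] at hx
  have hlog : Complex.exp (Complex.log z) = z := Complex.exp_log hz
  have harg0 : 0 ≤ (Complex.log z).im := by
    rw [Complex.log_im]; exact Complex.arg_nonneg_iff.2 hy
  have harg1 : (Complex.log z).im < Real.pi / 2 := by
    rw [Complex.log_im]
    exact lt_of_abs_lt (Complex.abs_arg_lt_pi_div_two_iff.2 (Or.inl hx))
  have hlim : Tendsto (fun α : ℝ => max M (C * Real.exp 1) *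
      Real.exp (Real.cos α / Real.sin α * ‖z‖ ^ 2))
      (nhdsWithin (Real.pi / 2) (Set.Iio (Real.pi / 2))) (nhds (max M (C * Real.exp 1))) := by
    have hc : ContinuousAt (fun α : ℝ => max M (C * Real.exp 1) *
        Real.exp (Real.cos α / Real.sin α * ‖z‖ ^ 2)) (Real.pi / 2) := by
      have : ContinuousAt (fun α : ℝ => Real.cos α / Real.sin α) (Real.pi / 2) :=
        Real.continuous_cos.continuousAt.div Real.continuous_sin.continuousAt (by simp)
      fun_prop
    have h := hc.tendsto
    simp only [Real.cos_pi_div_two, zero_div, zero_mul, Real.exp_zero, mul_one] at h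
    exact h.mono_left nhdsWithin_le_nhds
  refine ge_of_tendsto hlim ?_
  filter_upwards [Ioo_mem_nhdsLT harg1] with α hα
  have h := norm_exp_strip_le hG hb hM (harg0.trans_lt hα.1) hα.2 harg0 hα.1.le
  rwa [hlog] at h

theorem norm_le_of_real_axis {G : ℂ → ℂ} {C M : ℝ} (hG : Differentiable ℂ G)
    (hb : ∀ z : ℂ, ‖G z‖ ≤ C * Real.exp ((|z.re| + 1) ^ 2 / 2))
    (hM : ∀ x : ℝ, ‖G x‖ ≤ M) (z : ℂ) : ‖G z‖ ≤ max M (C * Real.exp 1) := by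
  have upper : ∀ G : ℂ → ℂ, Differentiable ℂ G →
      (∀ z : ℂ, ‖G z‖ ≤ C * Real.exp ((|z.re| + 1) ^ 2 / 2)) → (∀ x : ℝ, ‖G x‖ ≤ M) →
      ∀ z : ℂ, 0 ≤ z.re → ‖G z‖ ≤ max M (C * Real.exp 1) := by
    intro G hG hb hM z hx
    rcases le_total 0 z.im with hy | hy
    · exact norm_le_of_quadrant hG hb (fun x _ => hM x) hx hy
    · have h := norm_le_of_quadrant (G := fun z => star (G (star z))) (C := C) (M := M)
        (z := star z) (fun z => ?_) (fun z => ?_) (fun x _ => ?_)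
        (by simpa using hx) (by simpa using hy)
      · simpa using h
      · have h := (hG (star z)).star_star
        rwa [star_star] at h
      · rw [norm_star]; simpa using hb (star z)
      · rw [norm_star]; simpa using hM x
  rcases le_total 0 z.re with hx | hx
  · exact upper G hG hb hM z hx
  · have h := upper (fun z => G (-z)) (hG.comp differentiable_neg) (fun z => by simpa using hb (-z))
      (fun x => by simpa using hM (-x)) (-z) (by simpa using hx)
    simpa using h

/-- An entire function of growth `e^((re z)²/2)` that is square integrable on the real axis vanishes.
Differences `P(z + h) - P(z)` of a primitive, with `0 ≤ h ≤ 1`, are bounded on the real axis and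
grow at most like `e^((|re z| + 1)²/2)`, hence are constant by Liouville's theorem; so `F` is invariant under
real translations. -/
theorem eq_zero_of_growth {F : ℂ → ℂ} {C : ℝ} (hF : Differentiable ℂ F)
    (hb : ∀ z : ℂ, ‖F z‖ ≤ C * Real.exp (z.re ^ 2 / 2))
    (hL : MemLp (fun x : ℝ => F x) 2 volume) : F = 0 := by
  have hC : 0 ≤ C := nonneg_of_mul_nonneg_left ((norm_nonneg _).trans (hb 0)) (Real.exp_pos _)
  obtain ⟨P, hP⟩ := hF.isExactOn_univ
  replace hP : ∀ z, HasDerivAt P (F z) z := fun z => hP z (Set.mem_univ z)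
  have hsq : Integrable (fun x : ℝ => ‖F x‖ ^ 2) volume := hL.integrable_norm_pow (by norm_num)
  have hper : ∀ h : ℝ, 0 ≤ h → h ≤ 1 → ∀ z : ℂ, F (z + h) = F z := by
    intro h h0 h1 z
    have hd : ∀ z : ℂ, HasDerivAt (fun z : ℂ => P (z + h) - P z) (F (z + h) - F z) z := fun z =>
      ((hP (z + h)).comp_add_const z h).sub (hP z)
    have hGd : Differentiable ℂ (fun z : ℂ => P (z + h) - P z) :=
      fun z => (hd z).differentiableAt
    have hbd : ∀ z : ℂ, ‖P (z + h) - P z‖ ≤ C * Real.exp ((|z.re| + 1) ^ 2 / 2) := by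
      intro z
      have hmv := Convex.norm_image_sub_le_of_norm_hasDerivWithin_le (f := P) (f' := F)
        (s := segment ℝ z (z + h)) (x := z) (y := z + h)
        (C := C * Real.exp ((|z.re| + 1) ^ 2 / 2))
        (fun w _ => (hP w).hasDerivWithinAt) (fun w hw => ?_) (convex_segment _ _)
        (left_mem_segment _ _ _) (right_mem_segment _ _ _)
      · refine hmv.trans (mul_le_of_le_one_right (by positivity) ?_)
        simpa [abs_of_nonneg h0] using h1
      · rw [segment_eq_image'] at hw
        obtain ⟨t, ht, rfl⟩ := hw
        refine (hb _).trans ?_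
        have h2 : |(z + t • (z + (h : ℂ) - z)).re| ≤ |z.re| + 1 := by
          simp only [add_sub_cancel_left, Complex.add_re, Complex.real_smul, Complex.mul_re,
            Complex.ofReal_re, Complex.ofReal_im, mul_zero, sub_zero]
          refine (abs_add_le _ _).trans ?_
          gcongr
          rw [abs_of_nonneg (mul_nonneg ht.1 h0)]
          nlinarith [ht.1, ht.2]
        rw [← sq_abs (Complex.re _)]
        gcongr
    have hreal : ∀ x : ℝ, ‖P ((x : ℂ) + h) - P x‖ ≤ (1 + ∫ x : ℝ, ‖F x‖ ^ 2) / 2 := by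
      intro x
      have hcont : Continuous (fun t : ℝ => F t) := hF.continuous.comp Complex.continuous_ofReal
      have hftc : ∫ t in x..(x + h), F t = P ((x : ℂ) + h) - P x := by
        have := intervalIntegral.integral_eq_sub_of_hasDerivAt (f := fun t : ℝ => P t)
          (f' := fun t : ℝ => F t) (a := x) (b := x + h)
          (fun t _ => (hP t).comp_ofReal) (hcont.intervalIntegrable _ _)
        simpa using this
      rw [← hftc]
      calc _ ≤ ∫ t in x..(x + h), ‖F t‖ :=
            intervalIntegral.norm_integral_le_integral_norm (by linarith)
        _ ≤ ∫ t in x..(x + h), (1 + ‖F t‖ ^ 2) / 2 := by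
            refine intervalIntegral.integral_mono_on (by linarith)
              (hcont.norm.intervalIntegrable _ _)
              ((((hcont.norm.pow 2).const_add 1).div_const 2).intervalIntegrable _ _) fun t _ => ?_
            nlinarith [sq_nonneg (‖F t‖ - 1)]
        _ = (h + ∫ t in x..(x + h), ‖F t‖ ^ 2) / 2 := by
            rw [intervalIntegral.integral_div, intervalIntegral.integral_add
              (g := fun t : ℝ => ‖F t‖ ^ 2) (by simp) ((hcont.norm.pow 2).intervalIntegrable _ _)]
            simp
        _ ≤ _ := by
            gcongr
            rw [intervalIntegral.integral_of_le (by linarith)]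
            exact setIntegral_le_integral hsq (Eventually.of_forall fun t => by positivity)
    have hconst := hGd.apply_eq_apply_of_bounded (isBounded_iff_forall_norm_le.2
      ⟨_, Set.forall_mem_range.2 (norm_le_of_real_axis hGd hbd hreal)⟩)
    have hz : HasDerivAt (fun z : ℂ => P (z + h) - P z) 0 z := by
      have : (fun z : ℂ => P (z + h) - P z) = fun _ => P (0 + h) - P 0 :=
        funext fun z => hconst z 0
      rw [this]
      exact hasDerivAt_const _ _
    exact sub_eq_zero.1 ((hd z).unique hz)
  -- A step of length `x / n ≤ 1`, repeated `n` times, reaches any `x ≥ 0`.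
  have hmul : ∀ (n : ℕ) (h : ℝ), 0 ≤ h → h ≤ 1 → F ((n * h : ℝ)) = F 0 := by
    intro n h h0 h1
    induction n with
    | zero => simp
    | succ n ih => rw [← ih, ← hper h h0 h1 (n * h : ℝ)]; congr 1; push_cast; ring
  have hpos : ∀ x : ℝ, 0 ≤ x → F x = F 0 := by
    intro x hx
    obtain ⟨n, hn⟩ := exists_nat_gt x
    have hn0 : (0 : ℝ) < n := hx.trans_lt hn
    have := hmul n (x / n) (by positivity) ((div_le_one hn0).2 hn.le)
    rwa [mul_div_cancel₀ _ hn0.ne'] at this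
  have hF0 : F 0 = 0 := by
    by_contra hne
    have h1 : IntegrableOn (fun _ : ℝ => ‖F 0‖ ^ 2) (Set.Ici 0) volume :=
      (hsq.integrableOn).congr_fun (fun x hx => by simp only [hpos x hx]) measurableSet_Ici
    rw [integrableOn_const_iff] at h1
    simp [hne] at h1
  have han : AnalyticOnNhd ℂ F Set.univ := hF.differentiableOn.analyticOnNhd isOpen_univ
  have hfreq : ∃ᶠ z in nhdsWithin (0 : ℂ) {0}ᶜ, F z = (fun _ => 0 : ℂ → ℂ) z := by
    have ht : Tendsto (fun x : ℝ => (x : ℂ)) (nhdsWithin 0 (Set.Ioi 0)) (nhdsWithin 0 {0}ᶜ) := by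
      refine tendsto_nhdsWithin_iff.2 ⟨?_, ?_⟩
      · exact (Complex.continuous_ofReal.tendsto' 0 0 (by simp)).mono_left nhdsWithin_le_nhds
      · filter_upwards [self_mem_nhdsWithin] with x hx
        simpa using (ne_of_gt hx)
    refine ht.frequently (Eventually.frequently ?_)
    filter_upwards [self_mem_nhdsWithin] with x hx
    rw [hpos x (le_of_lt hx), hF0]
  exact funext fun z => han.eqOn_of_preconnected_of_frequently_eq analyticOnNhd_const
    isPreconnected_univ (Set.mem_univ 0) hfreq (Set.mem_univ z)

end GaussianGrowth

/-! ### Functions of Gaussian decay together with their Fourier transform -/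

namespace L2Line

/-- The Fourier transform on `L²` is given by the Fourier integral on `L¹ ∩ L²`: both define the
same tempered distribution. -/
theorem fourier_ae_eq_of_integrable (f : L2R) (hf : Integrable f volume) :
    (𝓕 f : L2R) =ᵐ[volume] 𝓕 (f : ℝ → ℂ) := by
  have hcont : Continuous (𝓕 (f : ℝ → ℂ)) :=
    VectorFourier.fourierIntegral_continuous Real.continuous_fourierChar
      (L := innerₗ ℝ) continuous_inner hf
  refine ae_eq_of_integral_contDiff_smul_eq ((Lp.memLp (𝓕 f : L2R)).locallyIntegrable one_le_two)
    hcont.locallyIntegrable fun g hg hgs => ?_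
  have h1 : HasCompactSupport (fun x => (g x : ℂ)) := hgs.comp_left Complex.ofReal_zero
  have h2 : ContDiff ℝ ((⊤ : ℕ∞) : WithTop ℕ∞) (fun x => (g x : ℂ)) :=
    Complex.ofRealCLM.contDiff.comp hg
  set φ : SchwartzMap ℝ ℂ := h1.toSchwartzMap h2 with hφ
  have hφx : ∀ x, φ x = g x := fun x => rfl
  have h3 := congrArg (fun d => d φ) (Lp.fourier_toTemperedDistribution_eq f)
  simp only [TemperedDistribution.fourier_apply, Lp.toTemperedDistribution_apply] at h3
  have h4 : ∫ x, 𝓕 φ x • f x = ∫ x, φ x • 𝓕 (f : ℝ → ℂ) x := by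
    simpa using! VectorFourier.integral_fourierIntegral_smul_eq_flip (L := innerₗ ℝ)
      (f := φ) (g := f) (μ := volume) (ν := volume)
      Real.continuous_fourierChar continuous_inner φ.integrable hf
  rw [h4] at h3
  simpa [hφx] using h3.symm

/-- The Fourier–Laplace transform `z ↦ ∫ f(x) e^(-ixz) dx`. -/
noncomputable def fourierLaplace (f : ℝ → ℂ) (z : ℂ) : ℂ :=
  ∫ x : ℝ, f x * Complex.exp (-(Complex.I * x * z))

theorem norm_mul_cexp (c : ℂ) (x : ℝ) (z : ℂ) :
    ‖c * Complex.exp (-(Complex.I * x * z))‖ = ‖c‖ * Real.exp (x * z.im) := by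
  rw [norm_mul, Complex.norm_exp]
  simp

/-- The square is completed in `|f(x)| e^(xη) = |e^(x²/2) f(x)| e^(-(x-η)²/2) e^(η²/2)`, and the
product of the first two factors is at most half the sum of their squares. The integral of this
majorant depends on `η` only through `e^(η²/2)`. -/
theorem norm_mul_exp_le (f : ℝ → ℂ) (x η : ℝ) :
    ‖f x‖ * Real.exp (x * η) ≤ Real.exp (η ^ 2 / 2) *
      ((‖((Real.exp (x ^ 2 / 2) : ℝ) : ℂ) * f x‖ ^ 2 + Real.exp (-1 * (x - η) ^ 2)) / 2) := by
  have h1 : Real.exp (x * η) = Real.exp (η ^ 2 / 2) * Real.exp (x ^ 2 / 2) *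
      Real.exp (-(x - η) ^ 2 / 2) := by
    rw [← Real.exp_add, ← Real.exp_add]; congr 1; ring
  have h2 : Real.exp (-1 * (x - η) ^ 2) = Real.exp (-(x - η) ^ 2 / 2) ^ 2 := by
    rw [← Real.exp_nat_mul]; congr 1; push_cast; ring
  have h3 : ‖((Real.exp (x ^ 2 / 2) : ℝ) : ℂ) * f x‖ = Real.exp (x ^ 2 / 2) * ‖f x‖ := by
    rw [norm_mul, Complex.norm_real, Real.norm_of_nonneg (Real.exp_pos _).le]
  rw [h1, h2, h3]
  have h4 : Real.exp (x ^ 2 / 2) * ‖f x‖ * Real.exp (-(x - η) ^ 2 / 2) ≤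
      ((Real.exp (x ^ 2 / 2) * ‖f x‖) ^ 2 + Real.exp (-(x - η) ^ 2 / 2) ^ 2) / 2 := by
    nlinarith [sq_nonneg (Real.exp (x ^ 2 / 2) * ‖f x‖ - Real.exp (-(x - η) ^ 2 / 2))]
  calc _ = Real.exp (η ^ 2 / 2) *
      (Real.exp (x ^ 2 / 2) * ‖f x‖ * Real.exp (-(x - η) ^ 2 / 2)) := by ring
    _ ≤ _ := by gcongr

section GaussianDecay

variable {f : ℝ → ℂ}

theorem integrable_majorant
    (hu : MemLp (fun x => ((Real.exp (x ^ 2 / 2) : ℝ) : ℂ) * f x) 2 volume) (η : ℝ) :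
    Integrable (fun x => Real.exp (η ^ 2 / 2) *
      ((‖((Real.exp (x ^ 2 / 2) : ℝ) : ℂ) * f x‖ ^ 2 + Real.exp (-1 * (x - η) ^ 2)) / 2))
      volume :=
  (((hu.integrable_norm_pow (by norm_num)).add
    ((integrable_exp_neg_mul_sq one_pos).comp_sub_right η)).div_const 2).const_mul _

theorem integrable_norm_mul_exp (hf : AEStronglyMeasurable f volume)
    (hu : MemLp (fun x => ((Real.exp (x ^ 2 / 2) : ℝ) : ℂ) * f x) 2 volume) (η : ℝ) :
    Integrable (fun x => ‖f x‖ * Real.exp (x * η)) volume := by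
  refine (integrable_majorant hu η).mono' (hf.norm.mul (by fun_prop)) ?_
  refine Eventually.of_forall fun x => ?_
  rw [Real.norm_of_nonneg (by positivity)]
  exact norm_mul_exp_le f x η

theorem norm_fourierLaplace_le
    (hu : MemLp (fun x => ((Real.exp (x ^ 2 / 2) : ℝ) : ℂ) * f x) 2 volume) :
    ∃ C : ℝ, ∀ z : ℂ, ‖fourierLaplace f z‖ ≤ C * Real.exp (z.im ^ 2 / 2) := by
  refine ⟨((∫ x, ‖((Real.exp (x ^ 2 / 2) : ℝ) : ℂ) * f x‖ ^ 2) +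
    ∫ x : ℝ, Real.exp (-1 * x ^ 2)) / 2, fun z => ?_⟩
  have h1 : ‖fourierLaplace f z‖ ≤ ∫ x, Real.exp (z.im ^ 2 / 2) *
      ((‖((Real.exp (x ^ 2 / 2) : ℝ) : ℂ) * f x‖ ^ 2 + Real.exp (-1 * (x - z.im) ^ 2)) / 2) := by
    refine norm_integral_le_of_norm_le (integrable_majorant hu z.im)
      (Eventually.of_forall fun x => ?_)
    rw [norm_mul_cexp]
    exact norm_mul_exp_le f x z.im
  rwa [integral_const_mul, integral_div, integral_add (hu.integrable_norm_pow (by norm_num))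
    ((integrable_exp_neg_mul_sq one_pos).comp_sub_right z.im),
    integral_sub_right_eq_self (fun x : ℝ => Real.exp (-1 * x ^ 2)), mul_comm] at h1

theorem differentiable_fourierLaplace (hf : AEStronglyMeasurable f volume)
    (hu : MemLp (fun x => ((Real.exp (x ^ 2 / 2) : ℝ) : ℂ) * f x) 2 volume) :
    Differentiable ℂ (fourierLaplace f) := by
  intro z₀
  set R := ‖z₀‖ + 1 with hR
  have hmeas : ∀ z : ℂ, AEStronglyMeasurable
      (fun x : ℝ => f x * Complex.exp (-(Complex.I * x * z))) volume := fun z =>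
    hf.mul (by fun_prop)
  have h := hasDerivAt_integral_of_dominated_loc_of_deriv_le (μ := volume)
    (F := fun (z : ℂ) (x : ℝ) => f x * Complex.exp (-(Complex.I * x * z)))
    (F' := fun (z : ℂ) (x : ℝ) => f x * (Complex.exp (-(Complex.I * x * z)) * -(Complex.I * x)))
    (x₀ := z₀) (s := Metric.ball z₀ 1)
    (bound := fun x => ‖f x‖ * Real.exp (x * (R + 1)) + ‖f x‖ * Real.exp (x * (-(R + 1))))
    (Metric.ball_mem_nhds _ one_pos) (Eventually.of_forall hmeas) ?_ (hf.mul (by fun_prop)) ?_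
    ((integrable_norm_mul_exp hf hu _).add (integrable_norm_mul_exp hf hu _)) ?_
  · exact h.2.differentiableAt
  · refine (integrable_norm_mul_exp hf hu z₀.im).mono' (hmeas z₀) (Eventually.of_forall fun x => ?_)
    rw [norm_mul_cexp]
  · refine Eventually.of_forall fun x z hz => ?_
    have hz' : |z.im| ≤ R := by
      refine (Complex.abs_im_le_norm z).trans ?_
      have h1 : ‖z - z₀‖ < 1 := by simpa [dist_eq_norm] using hz
      have h2 := norm_le_norm_add_norm_sub' z z₀
      linarith
    rw [← mul_assoc, norm_mul, norm_mul_cexp, norm_neg, norm_mul, Complex.norm_I, one_mul,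
      Complex.norm_real, Real.norm_eq_abs, mul_assoc, ← mul_add]
    gcongr
    have h1 : |x| ≤ Real.exp |x| := by linarith [Real.add_one_le_exp |x|]
    have h2 : Real.exp (x * z.im) ≤ Real.exp (|x| * R) := by
      rw [Real.exp_le_exp]
      refine (le_abs_self _).trans ?_
      rw [abs_mul]
      gcongr
    calc _ ≤ Real.exp (|x| * R) * Real.exp |x| := by gcongr
      _ = Real.exp (|x| * (R + 1)) := by rw [← Real.exp_add]; congr 1; ring
      _ ≤ _ := by
        rcases abs_cases x with ⟨hx, -⟩ | ⟨hx, -⟩ <;> rw [hx]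
        · linarith [Real.exp_pos (x * (-(R + 1)))]
        · rw [neg_mul_comm]
          linarith [Real.exp_pos (x * (R + 1))]
  · refine Eventually.of_forall fun x z _ => ?_
    have h1 : HasDerivAt (fun z : ℂ => -(Complex.I * x * z)) (-(Complex.I * x)) z := by
      simpa using ((hasDerivAt_id z).const_mul (Complex.I * (x : ℂ))).fun_neg
    exact h1.cexp.const_mul (f x)

end GaussianDecay

theorem fourierL2_ae_eq (f : L2R) (hf : Integrable f volume) :
    fourierL2 f =ᵐ[volume] fun ξ : ℝ =>
      ((√(2 * Real.pi)⁻¹ : ℝ) : ℂ) * fourierLaplace f ξ := by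
  have hc : (0 : ℝ) < (2 * Real.pi)⁻¹ := by positivity
  have h0 : fourierL2 f = dilationₗᵢ _ hc (𝓕 f) := rfl
  rw [h0]
  filter_upwards [dilationₗᵢ_coeFn hc (𝓕 f), (quasiMeasurePreserving_mul hc.ne').ae
    (fourier_ae_eq_of_integrable f hf)] with ξ h1 h2
  rw [h1, h2, Real.fourier_real_eq_integral_exp_smul, fourierLaplace]
  congr 1
  refine integral_congr_ae (Eventually.of_forall fun x => ?_)
  simp only [smul_eq_mul]
  rw [mul_comm]
  congr 2
  have hπ : (Real.pi : ℂ) ≠ 0 := by exact_mod_cast Real.pi_ne_zero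
  push_cast
  field_simp

theorem norm_fourierL2 (f : L2R) : ‖fourierL2 f‖ = ‖f‖ :=
  LinearIsometry.norm_map ((dilationₗᵢ (2 * Real.pi)⁻¹ (by positivity)).comp
    (Lp.fourierTransformₗᵢ ℝ ℂ).toLinearIsometry) f

/-- The `L²` form of Hardy's uncertainty principle at the critical exponent: `f` and its Fourier
transform cannot both lie in `D(A)` unless `f = 0`. The function
`F(z) = e^(z²/2) ∫ f(x) e^(-ixz) dx` is entire, of growth `e^((re z)²/2)`, and square integrable on
the real axis. -/
theorem eq_zero_of_mem_opA_domain {f : L2R} (hf : f ∈ opA.domain)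
    (hf' : fourierL2 f ∈ opA.domain) : f = 0 := by
  have hu : MemLp (fun x => ((Real.exp (x ^ 2 / 2) : ℝ) : ℂ) * f x) 2 volume := hf
  have hv : MemLp (fun x => ((Real.exp (x ^ 2 / 2) : ℝ) : ℂ) * (fourierL2 f) x) 2 volume := hf'
  have hm := Lp.aestronglyMeasurable f
  have hint : Integrable f volume := by
    have h := integrable_norm_mul_exp hm hu 0
    simp only [mul_zero, Real.exp_zero, mul_one] at h
    exact (integrable_norm_iff hm).1 h
  have hae := fourierL2_ae_eq f hint
  set c : ℝ := √(2 * Real.pi)⁻¹ with hc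
  have hc0 : (c : ℂ) ≠ 0 := by
    have : 0 < c := Real.sqrt_pos.2 (by positivity)
    exact_mod_cast this.ne'
  set F : ℂ → ℂ := fun z => Complex.exp (z ^ 2 / 2) * fourierLaplace f z with hF
  have hFd : Differentiable ℂ F :=
    (((differentiable_id.pow 2).div_const 2).cexp).mul (differentiable_fourierLaplace hm hu)
  obtain ⟨C, hC⟩ := norm_fourierLaplace_le hu
  have hFb : ∀ z : ℂ, ‖F z‖ ≤ C * Real.exp (z.re ^ 2 / 2) := by
    intro z
    have h1 : (z ^ 2 / 2).re = z.re ^ 2 / 2 - z.im ^ 2 / 2 := by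
      have : z ^ 2 / 2 = ((1 / 2 : ℝ) : ℂ) * (z * z) := by push_cast; ring
      rw [this, Complex.re_ofReal_mul, Complex.mul_re]
      ring
    calc ‖F z‖ = Real.exp (z.re ^ 2 / 2 - z.im ^ 2 / 2) * ‖fourierLaplace f z‖ := by
          rw [hF]; simp only [norm_mul, Complex.norm_exp, h1]
      _ ≤ Real.exp (z.re ^ 2 / 2 - z.im ^ 2 / 2) * (C * Real.exp (z.im ^ 2 / 2)) := by
          gcongr; exact hC z
      _ = C * Real.exp (z.re ^ 2 / 2) := by
          rw [mul_left_comm, ← Real.exp_add, sub_add_cancel]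
  have hFL : MemLp (fun x : ℝ => F x) 2 volume := by
    refine (memLp_congr_ae ?_).1 (hv.const_mul (c : ℂ)⁻¹)
    filter_upwards [hae] with ξ h1
    rw [h1, hF]
    push_cast
    field_simp
  have h0 := GaussianGrowth.eq_zero_of_growth hFd hFb hFL
  have hL0 : fourierL2 f = 0 := by
    refine Lp.ext ?_
    filter_upwards [hae, Lp.coeFn_zero ℂ 2 (volume : Measure ℝ)] with ξ h1 h2
    have h3 := (mul_eq_zero.1 (congrFun h0 (ξ : ℂ))).resolve_left (Complex.exp_ne_zero _)
    rw [h1, h2, h3, mul_zero]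
    rfl
  rw [← norm_eq_zero, ← norm_fourierL2, hL0, norm_zero]

end L2Line

/-! ### Operators whose adjoint has trivial domain -/

namespace UnboundedOp

variable {H : Type*} [NormedAddCommGroup H] [InnerProductSpace ℂ H]

theorem isParanormal_of_sq_domain_eq_bot {T : H →ₗ.[ℂ] H} (h : (sq T).domain = ⊥) :
    IsParanormal T := by
  intro x
  have hx : (x : H) = 0 := (Submodule.mem_bot ℂ).1 (h ▸ x.2)
  have h0 : (⟨x, mem_domain_of_mem_sq x⟩ : T.domain) = 0 := Subtype.ext hx
  rw [h0, LinearPMap.map_zero, hx]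
  simp

/-- The orthogonal complement of the graph of `T` is a rotated copy of the graph of the adjoint, so
an adjoint with trivial domain makes the graph dense in `H × H`. -/
theorem dense_graph_of_adjoint_domain_eq_bot [CompleteSpace H] {T : H →ₗ.[ℂ] H}
    (hT : Dense (T.domain : Set H)) (h : (LinearPMap.adjoint T).domain = ⊥) :
    Dense (T.graph : Set (H × H)) := by
  set e := WithLp.prodContinuousLinearEquiv 2 ℂ H H
  set K : Submodule ℂ (WithLp 2 (H × H)) := T.graph.comap (e : WithLp 2 (H × H) →ₗ[ℂ] H × H) with hK
  have hperp : Kᗮ = ⊥ := by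
    refine (Submodule.eq_bot_iff _).2 fun w hw => ?_
    have hort : ∀ x : T.domain, inner ℂ (x : H) w.fst + inner ℂ (T x) w.snd = 0 := by
      intro x
      have hmem : WithLp.toLp 2 ((x : H), T x) ∈ K := T.mem_graph x
      simpa using (Submodule.mem_orthogonal _ _).1 hw _ hmem
    have hsnd : w.snd ∈ (LinearPMap.adjoint T).domain := by
      refine LinearPMap.mem_adjoint_domain_of_exists _ ⟨-w.fst, fun x => ?_⟩
      have := congrArg (starRingEnd ℂ) (hort x)
      rw [map_add, inner_conj_symm, inner_conj_symm, map_zero] at this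
      rw [inner_neg_left]
      linear_combination -this
    rw [h, Submodule.mem_bot] at hsnd
    have hfst : w.fst = 0 := hT.eq_zero_of_inner_right ℂ fun v hv => by
      simpa [hsnd] using hort ⟨v, hv⟩
    exact (WithLp.ofLp_injective 2) (Prod.ext hfst hsnd)
  have hd : Dense (K : Set (WithLp 2 (H × H))) :=
    Submodule.dense_iff_topologicalClosure_eq_top.2
      ((Submodule.topologicalClosure_eq_top_iff).2 hperp)
  have him : (T.graph : Set (H × H)) = e '' (K : Set (WithLp 2 (H × H))) := by
    ext p
    exact ⟨fun hp => ⟨e.symm p, by simpa [hK] using hp, e.apply_symm_apply p⟩,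
      by rintro ⟨q, hq, rfl⟩; exact hq⟩
  rw [him]
  exact e.surjective.denseRange.dense_image e.continuous hd

theorem not_isClosable_of_dense_graph [Nontrivial H] {T : H →ₗ.[ℂ] H}
    (h : Dense (T.graph : Set (H × H))) : ¬ T.IsClosable := by
  rintro ⟨S, hS⟩
  obtain ⟨v, hv⟩ := exists_ne (0 : H)
  have hmem : ((0 : H), v) ∈ S.graph := by
    rw [← hS]
    exact h _
  exact hv (S.graph_fst_eq_zero_snd hmem rfl)

end UnboundedOp

/-! ### The operator `T = A⁻¹ B` -/

namespace L2Line

theorem dilationₗᵢ_surjective {c : ℝ} (hc : 0 < c) : Function.Surjective (dilationₗᵢ c hc) := by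
  intro g
  have hc' : 0 < c⁻¹ := inv_pos.2 hc
  refine ⟨dilationₗᵢ c⁻¹ hc' g, Lp.ext ?_⟩
  filter_upwards [dilationₗᵢ_coeFn hc (dilationₗᵢ c⁻¹ hc' g),
    (quasiMeasurePreserving_mul hc.ne').ae (dilationₗᵢ_coeFn hc' g)] with x h1 h2
  rw [h1, h2, inv_mul_cancel_left₀ hc.ne', ← mul_assoc, ← Complex.ofReal_mul,
    ← Real.sqrt_mul hc.le, mul_inv_cancel₀ hc.ne', Real.sqrt_one, Complex.ofReal_one, one_mul]

theorem fourierL2_surjective : Function.Surjective fourierL2 :=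
  (dilationₗᵢ_surjective (c := (2 * Real.pi)⁻¹) (by positivity)).comp
    (Lp.fourierTransformₗᵢ ℝ ℂ).surjective

theorem adjoint_fourierL2_apply (f : L2R) :
    ContinuousLinearMap.adjoint fourierL2 (fourierL2 f) = f :=
  DFunLike.congr_fun ((ContinuousLinearMap.norm_map_iff_adjoint_comp_self _).1 norm_fourierL2) f

theorem fourierL2_adjoint_apply (f : L2R) :
    fourierL2 (ContinuousLinearMap.adjoint fourierL2 f) = f := by
  obtain ⟨g, rfl⟩ := fourierL2_surjective f
  rw [adjoint_fourierL2_apply]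

theorem opA_coeFn (f : opA.domain) :
    opA f =ᵐ[volume] fun x => ((Real.exp (x ^ 2 / 2) : ℝ) : ℂ) * (f : L2R) x :=
  MemLp.coeFn_toLp f.2

theorem opA_symmetric (f g : opA.domain) :
    inner ℂ (opA f) (g : L2R) = inner ℂ (f : L2R) (opA g) := by
  rw [L2.inner_def, L2.inner_def]
  refine integral_congr_ae ?_
  filter_upwards [opA_coeFn f, opA_coeFn g] with x hf hg
  rw [hf, hg]
  simp only [RCLike.inner_apply, map_mul, Complex.conj_ofReal]
  ring

theorem opA_surjective (u : L2R) : ∃ f : opA.domain, opA f = u := by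
  have hf : MemLp (fun x => ((Real.exp (-(x ^ 2 / 2)) : ℝ) : ℂ) * u x) 2 volume := by
    refine (Lp.memLp u).of_le ((by fun_prop : AEStronglyMeasurable
      (fun x : ℝ => ((Real.exp (-(x ^ 2 / 2)) : ℝ) : ℂ)) volume).mul (Lp.aestronglyMeasurable u))
      (Eventually.of_forall fun x => ?_)
    rw [norm_mul, Complex.norm_real, Real.norm_of_nonneg (Real.exp_pos _).le]
    refine mul_le_of_le_one_left (norm_nonneg _) (Real.exp_le_one_iff.2 ?_)
    linarith [sq_nonneg x]
  set v : L2R := hf.toLp _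
  have hae : (fun x => ((Real.exp (x ^ 2 / 2) : ℝ) : ℂ) * v x) =ᵐ[volume] u := by
    filter_upwards [hf.coeFn_toLp] with x hx
    rw [hx, ← mul_assoc, ← Complex.ofReal_mul, ← Real.exp_add, add_neg_cancel, Real.exp_zero,
      Complex.ofReal_one, one_mul]
  have hmem : v ∈ opA.domain := (memLp_congr_ae hae).2 (Lp.memLp u)
  exact ⟨⟨v, hmem⟩, Lp.ext ((opA_coeFn ⟨v, hmem⟩).trans hae)⟩

theorem mem_inverse_opA_domain (u : L2R) : u ∈ opA.inverse.domain := by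
  rw [LinearPMap.inverse_domain]
  exact opA_surjective u

/-- The everywhere defined inverse of `A`. -/
noncomputable def opAInv (u : L2R) : L2R := opA.inverse ⟨u, mem_inverse_opA_domain u⟩

theorem opAInv_opA (f : opA.domain) : opAInv (opA f) = f :=
  LinearPMap.inverse_apply_eq ker_opA rfl

theorem opAInv_mem (u : L2R) : opAInv u ∈ opA.domain := by
  obtain ⟨f, rfl⟩ := opA_surjective u
  rw [opAInv_opA]
  exact f.2

theorem opA_opAInv (u : L2R) : opA ⟨opAInv u, opAInv_mem u⟩ = u := by
  obtain ⟨f, rfl⟩ := opA_surjective u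
  exact congrArg opA (Subtype.ext (opAInv_opA f))

theorem opAInv_eq_zero {u : L2R} (h : opAInv u = 0) : u = 0 := by
  rw [← opA_opAInv u, ← opA.map_zero]
  exact congrArg opA (Subtype.ext h)

theorem opAInv_symmetric (u v : L2R) : inner ℂ (opAInv u) v = inner ℂ u (opAInv v) := by
  have h := opA_symmetric ⟨opAInv u, opAInv_mem u⟩ ⟨opAInv v, opAInv_mem v⟩
  rw [opA_opAInv, opA_opAInv] at h
  exact h.symm

theorem mem_opT_domain {f : L2R} : f ∈ opT.domain ↔ fourierL2 f ∈ opA.domain := by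
  constructor
  · intro h
    obtain ⟨h1, -⟩ := UnboundedOp.mem_prod_domain.1 h
    obtain ⟨h2, -⟩ := UnboundedOp.mem_prod_domain.1 h1
    obtain ⟨_, h3⟩ := UnboundedOp.mem_prod_domain.1 h2
    exact h3
  · intro h
    exact UnboundedOp.mem_prod_domain.2 ⟨UnboundedOp.mem_prod_domain.2
      ⟨UnboundedOp.mem_prod_domain.2 ⟨trivial, h⟩, trivial⟩, mem_inverse_opA_domain _⟩

theorem opT_apply (f : opT.domain) :
    opT f = opAInv (ContinuousLinearMap.adjoint fourierL2
      (opA ⟨fourierL2 f, mem_opT_domain.1 f.2⟩)) :=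
  rfl

theorem opT_apply_mem (f : opT.domain) : opT f ∈ opA.domain := by
  rw [opT_apply]
  exact opAInv_mem _

theorem opT_eq_zero {f : opT.domain} (h : opT f = 0) : (f : L2R) = 0 := by
  rw [opT_apply] at h
  have h1 := congrArg fourierL2 (opAInv_eq_zero h)
  rw [fourierL2_adjoint_apply, map_zero] at h1
  have h2 := congrArg opAInv h1
  rw [opAInv_opA, ← opA.map_zero, opAInv_opA] at h2
  rw [← norm_eq_zero, ← norm_fourierL2, norm_eq_zero]
  exact h2

theorem adjoint_opAInv_mem (u : L2R) :
    ContinuousLinearMap.adjoint fourierL2 (opAInv u) ∈ opT.domain := by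
  rw [mem_opT_domain, fourierL2_adjoint_apply]
  exact opAInv_mem u

/-- On vectors of the form `ℱ* A⁻¹ u`, the operator `T = A⁻¹ ℱ* A ℱ` acts as `A⁻¹ ℱ* u`. -/
theorem opT_adjoint_opAInv (u : L2R) :
    opT ⟨ContinuousLinearMap.adjoint fourierL2 (opAInv u), adjoint_opAInv_mem u⟩ =
      opAInv (ContinuousLinearMap.adjoint fourierL2 u) := by
  rw [opT_apply]
  congr 2
  exact (congrArg opA (Subtype.ext (fourierL2_adjoint_apply (opAInv u)))).trans (opA_opAInv u)

theorem dense_opT_domain : Dense (opT.domain : Set L2R) := by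
  rw [Submodule.dense_iff_topologicalClosure_eq_top, Submodule.topologicalClosure_eq_top_iff,
    Submodule.eq_bot_iff]
  intro v hv
  have h : opAInv (fourierL2 v) = 0 := by
    refine ext_inner_left ℂ fun u => ?_
    rw [← opAInv_symmetric, ← ContinuousLinearMap.adjoint_inner_left, inner_zero_right]
    exact (Submodule.mem_orthogonal _ _).1 hv _ (adjoint_opAInv_mem u)
  rw [← norm_eq_zero, ← norm_fourierL2, opAInv_eq_zero h, norm_zero]

/-- If `f ∈ D(T²)`, then `T f` lies in the range of `A⁻¹` and its Fourier transform in `D(A)`, so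
`T f = 0`; and `T` is injective. -/
theorem sq_opT_domain : (UnboundedOp.sq opT).domain = ⊥ := by
  refine (Submodule.eq_bot_iff _).2 fun f hf => ?_
  obtain ⟨h1, h2⟩ := UnboundedOp.mem_prod_domain.1 hf
  exact opT_eq_zero (eq_zero_of_mem_opA_domain (opT_apply_mem ⟨f, h1⟩) (mem_opT_domain.1 h2))

/-- If `g ∈ D(T*)`, then `ℱ A⁻¹ g = A⁻¹ ℱ T* g`, so `A⁻¹ g` and its Fourier transform both lie in
`D(A)`. -/
theorem adjoint_opT_domain : (LinearPMap.adjoint opT).domain = ⊥ := by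
  refine (Submodule.eq_bot_iff _).2 fun g hg => ?_
  set y := (LinearPMap.adjoint opT) ⟨g, hg⟩
  have h : fourierL2 (opAInv g) = opAInv (fourierL2 y) := by
    refine ext_inner_right ℂ fun u => ?_
    have h1 := LinearPMap.adjoint_isFormalAdjoint dense_opT_domain ⟨g, hg⟩
      ⟨_, adjoint_opAInv_mem u⟩
    rw [opT_adjoint_opAInv] at h1
    rw [opAInv_symmetric, ← ContinuousLinearMap.adjoint_inner_right,
      ← ContinuousLinearMap.adjoint_inner_right, opAInv_symmetric]
    exact h1.symm
  refine opAInv_eq_zero (eq_zero_of_mem_opA_domain (opAInv_mem g) ?_)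
  rw [h]
  exact opAInv_mem _

instance : Nontrivial L2R := by
  refine ⟨⟨indicatorConstLp 2 (μ := (volume : Measure ℝ)) (s := Set.Icc 0 1) measurableSet_Icc
    (by simp) (1 : ℂ), 0, fun h => ?_⟩⟩
  have h1 := congrArg norm h
  rw [norm_indicatorConstLp (by norm_num) (by norm_num)] at h1
  simp at h1

end L2Line

theorem mainTheorem1 :
    (∀ (H : Type*) [NormedAddCommGroup H] [InnerProductSpace ℂ H] [CompleteSpace H] [Nontrivial H]
      (T : H →ₗ.[ℂ] H), Dense (T.domain : Set H) →
      (UnboundedOp.sq T).domain = ⊥ → (LinearPMap.adjoint T).domain = ⊥ →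
      UnboundedOp.IsParanormal T ∧ ¬ T.IsClosable) ∧
    Dense (L2Line.opT.domain : Set L2Line.L2R) ∧
    (UnboundedOp.sq L2Line.opT).domain = ⊥ ∧
    (LinearPMap.adjoint L2Line.opT).domain = ⊥ ∧
    UnboundedOp.IsParanormal L2Line.opT ∧
    ¬ L2Line.opT.IsClosable := by
  refine ⟨fun H _ _ _ _ T hT hsq hadj => ⟨UnboundedOp.isParanormal_of_sq_domain_eq_bot hsq,
    UnboundedOp.not_isClosable_of_dense_graph
      (UnboundedOp.dense_graph_of_adjoint_domain_eq_bot hT hadj)⟩,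
    L2Line.dense_opT_domain, L2Line.sq_opT_domain, L2Line.adjoint_opT_domain,
    UnboundedOp.isParanormal_of_sq_domain_eq_bot L2Line.sq_opT_domain,
    UnboundedOp.not_isClosable_of_dense_graph
      (UnboundedOp.dense_graph_of_adjoint_domain_eq_bot L2Line.dense_opT_domain
        L2Line.adjoint_opT_domain)⟩
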